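/- Consider the planar two-link robot with flexible joints, with positions $q=(q_l,q_m)\in\mathbb R^2\times\mathbb R^2$, momenta $p=(p_l,p_m)\in\mathbb R^2\times\mathbb R^2$ and input $u\in\mathbb R^2$, in port-Hamiltonian form $$\begin{bmatrix}\dot q\\ \dot p\end{bmatrix}=\begin{bmatrix}0&I_4\\-I_4&-R_2\end{bmatrix}\begin{bmatrix}\nabla_qH(q,p)\\ \nabla_pH(q,p)\end{bmatrix}+\begin{bmatrix}0\\B\end{bmatrix}u,\qquad H(q,p)=\tfrac12p^\top M(q_{l_2})^{-1}p+\tfrac12\|q_l-q_m\|_{K_s}^2,$$ where $\|x\|_A^2:=x^\top Ax$, $M(\theta)=\operatorname{diag}(M_l(\theta),M_m)$, $$M_l(\theta)=\begin{bmatrix}a_1+a_2+2b\cos\theta&a_2+b\cos\theta\\a_2+b\cos\theta&a_2\end{bmatrix},$$ $R_2=\operatorname{diag}(D_l,D_m)$, $B=\begin{bmatrix}0\\I_2\end{bmatrix}$, the matrices $M_m,D_l,D_m,K_s\in\mathbb R^{2\times2}$ are diagonal with positive diagonal entries, $a_1,a_2,b>0$, and the inertia matrix $M_l(\theta)$ is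 positive definite for every $\theta\in\mathbb R$. Let $q_*\in\mathbb R^2$ and $\alpha_{l_i},\alpha_{m_i},\beta_{l_i},\beta_{m_i}>0$ for $i=1,2$, and let $R_{c_l},R_{c_m},K_c\in\mathbb R^{2\times2}$ be symmetric positive definite with $$R_{c_l}-\tfrac14\left(D_l^{-1}+D_m^{-1}\right)>0 .$$ For $x_{c_l},x_{c_m}\in\mathbb R^2$ put $z_l=q_l-q_*+x_{c_l}$, $z_m=q_m-q_*+x_{c_m}$, and $$\Phi_l(z_l)=\sum_{i=1}^2\frac{\alpha_{l_i}}{\beta_{l_i}}\ln\cosh(\beta_{l_i}z_{l_i}),\qquad \Phi_m(z_m)=\sum_{i=1}^2\frac{\alpha_{m_i}}{\beta_{m_i}}\ln\cosh(\beta_{m_i}z_{m_i}).$$ Consider the controller $$\dot x_{c_l}=-R_{c_l}\nabla_{x_{c_l}}\Phi_l(z_l),\qquad \dot x_{c_m}=-R_{c_m}\left[\nabla_{x_{c_m}}\Phi_m(z_m)+K_cx_{c_m}\right],\qquad u=-\nabla\Phi_l(z_l)-\nabla\Phi_m(z_m),$$ which uses only the positions $q$ and the controller states. Then: (i) $|u_i|\le\alpha_{l_i}+\alpha_{m_i}$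 for $i=1,2$ and all $q_l,q_m,x_{c_l},x_{c_m}\in\mathbb R^2$. (ii) With $\zeta=(q,p,x_{c_l},x_{c_m})\in\mathbb R^{12}$ and $$H_\zeta(\zeta)=H(q,p)+\Phi_l(z_l)+\Phi_m(z_m)+\tfrac12\|x_{c_m}\|_{K_c}^2,$$ the closed loop has the port-Hamiltonian form $\dot\zeta=F_\zeta\nabla H_\zeta(\zeta)$, where $$F_\zeta=\begin{bmatrix}0&I_4&0&0\\-I_4&-R_2&\Gamma_\zeta&0\\0&0&-R_{c_l}&0\\0&0&0&-R_{c_m}\end{bmatrix},\qquad \Gamma_\zeta=\begin{bmatrix}I_2\\-I_2\end{bmatrix},\qquad \tfrac12\left(F_\zeta+F_\zeta^\top\right)\le0 .$$ (iii) The point $\zeta_*$ with $q_l=q_m=q_*$, $p=0$, $x_{c_l}=x_{c_m}=0$ is an asymptotically stable equilibrium of the closed loop, with Lyapunov function $H_\zeta$: this function is continuously differentiable, vanishes at $\zeta_*$, is positive at every other point of $\mathbb R^{12}$, and does not increase along the closed-loop dynamics. -/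

import Mathlib

open Set Filter Topology Matrix

namespace FlexJointRobot

/-! ### General notions -/

/-- The gradient `∇ f (x)`: the column vector of the partial derivatives of `f` at `x`. -/
noncomputable def grad {ι : Type*} [Fintype ι] [DecidableEq ι]
    (f : (ι → ℝ) → ℝ) (x : ι → ℝ) : ι → ℝ :=
  fun i => fderiv ℝ f x (Pi.single i 1)

/-- The symmetric part `(A + Aᵀ) / 2` of a square matrix. -/
noncomputable def symPart {ι : Type*} (A : Matrix ι ι ℝ) : Matrix ι ι ℝ :=
  (1 / 2 : ℝ) • (A + Aᵀ)

/-- `x₀` is a (Lyapunov) stable equilibrium of `ẋ = f x`: solutions that start close enough to `x₀`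
stay as close to it as desired on their whole forward interval of definition, and for such initial
conditions there is a solution on all of `[0, ∞)`. -/
def IsStableEquilibrium {E : Type*} [NormedAddCommGroup E] [NormedSpace ℝ E]
    (f : E → E) (x₀ : E) : Prop :=
  f x₀ = 0 ∧
  ∀ ε > 0, ∃ δ > 0, ∀ ξ ∈ Metric.ball x₀ δ,
    (∃ x : ℝ → E, x 0 = ξ ∧ IsIntegralCurveOn x (fun _ => f) (Ici 0)) ∧
    ∀ T > 0, ∀ x : ℝ → E, x 0 = ξ → IsIntegralCurveOn x (fun _ => f) (Ico 0 T) →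
      ∀ t ∈ Ico 0 T, x t ∈ Metric.ball x₀ ε

/-- `x₀` is an asymptotically stable equilibrium of `ẋ = f x`: it is stable, and all solutions that
start close enough to `x₀` converge to it. -/
def IsAsymptoticallyStable {E : Type*} [NormedAddCommGroup E] [NormedSpace ℝ E]
    (f : E → E) (x₀ : E) : Prop :=
  IsStableEquilibrium f x₀ ∧
  ∃ δ > 0, ∀ x : ℝ → E, x 0 ∈ Metric.ball x₀ δ → IsIntegralCurveOn x (fun _ => f) (Ici 0) →
    Tendsto x atTop (𝓝 x₀)

/-- `V` is a Lyapunov function for the equilibrium `x₀` of `ẋ = f x` on the domain `D`: it is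
continuously differentiable and positive definite around `x₀`, and does not increase along the
vector field `f`. -/
structure IsLyapunovFunctionOn {E : Type*} [NormedAddCommGroup E] [NormedSpace ℝ E]
    (f : E → E) (x₀ : E) (V : E → ℝ) (D : Set E) : Prop where
  isOpen : IsOpen D
  mem : x₀ ∈ D
  contDiffOn : ContDiffOn ℝ 1 V D
  zero : V x₀ = 0
  pos : ∀ x ∈ D, x ≠ x₀ → 0 < V x
  deriv_nonpos : ∀ x ∈ D, fderiv ℝ V x (f x) ≤ 0

/-! ### The robot -/

/-- Vectors in `ℝ²`. -/
abbrev Vec2 : Type := Fin 2 → ℝ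

/-- Indices of the vectors in `ℝ⁴`, split into links (left) and motors (right). -/
abbrev LM : Type := Fin 2 ⊕ Fin 2

/-- Parameters of the two-link planar robot with flexible joints: inertia constants `a₁, a₂, b` of
the links, moments of inertia `Im` of the motors, damping `Dl, Dm` of links and motors, and spring
constants `ks` of the joints. -/
structure Robot where
  a₁ : ℝ
  a₂ : ℝ
  b : ℝ
  Im : Vec2
  Dl : Vec2
  Dm : Vec2
  ks : Vec2

namespace Robot

/-- All the parameters of the robot are positive. -/
structure Positive (P : Robot) : Prop where
  a₁_pos : 0 < P.a₁
  a₂_pos : 0 < P.a₂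
  b_pos : 0 < P.b
  Im_pos : ∀ i, 0 < P.Im i
  Dl_pos : ∀ i, 0 < P.Dl i
  Dm_pos : ∀ i, 0 < P.Dm i
  ks_pos : ∀ i, 0 < P.ks i

variable (P : Robot)

/-- The inertia matrix `M_l` of the links, as a function of the angle of the second link. -/
noncomputable def Ml (θ : ℝ) : Matrix (Fin 2) (Fin 2) ℝ :=
  !![P.a₁ + P.a₂ + 2 * P.b * Real.cos θ, P.a₂ + P.b * Real.cos θ;
     P.a₂ + P.b * Real.cos θ, P.a₂]

/-- The inertia matrix `M = diag (M_l, M_m)`. -/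
noncomputable def M (θ : ℝ) : Matrix LM LM ℝ :=
  fromBlocks (P.Ml θ) 0 0 (diagonal P.Im)

/-- The damping matrix `R₂ = diag (D_l, D_m)`. -/
noncomputable def R2 : Matrix LM LM ℝ :=
  fromBlocks (diagonal P.Dl) 0 0 (diagonal P.Dm)

/-- The stiffness matrix `K_s`. -/
noncomputable def Ks : Matrix (Fin 2) (Fin 2) ℝ := diagonal P.ks

/-- The Hamiltonian
`H(q, p) = ½ pᵀ M(q_{l₂})⁻¹ p + ½ ‖q_l - q_m‖²_{K_s}`, where `q = (q_l, q_m)`. -/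
noncomputable def H (q p : LM → ℝ) : ℝ :=
  (1 / 2) * (p ⬝ᵥ (P.M (q (Sum.inl 1)))⁻¹ *ᵥ p) +
  (1 / 2) * ((q ∘ Sum.inl - q ∘ Sum.inr) ⬝ᵥ P.Ks *ᵥ (q ∘ Sum.inl - q ∘ Sum.inr))

/-- The input matrix `B = [0; I]`: the torques act on the motors. -/
def B : Matrix LM (Fin 2) ℝ := fromRows 0 1

/-- The right-hand side `(q̇, ṗ)` of the port-Hamiltonian dynamics of the robot with input `u`. -/
noncomputable def plant (q p : LM → ℝ) (u : Vec2) : LM ⊕ LM → ℝ :=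
  fromBlocks 0 1 (-1) (-P.R2) *ᵥ
      Sum.elim (grad (fun q' => P.H q' p) q) (grad (fun p' => P.H q p') p) +
    fromRows 0 B *ᵥ u

end Robot

/-! ### The controller -/

/-- Parameters of the controller: reference `qs` (that is, `q_*`), saturation levels `αl, αm`,
slopes `βl, βm`, and gain matrices `Rcl, Rcm, Kc`. -/
structure Controller where
  qs : Vec2
  αl : Vec2
  αm : Vec2
  βl : Vec2
  βm : Vec2
  Rcl : Matrix (Fin 2) (Fin 2) ℝ
  Rcm : Matrix (Fin 2) (Fin 2) ℝ
  Kc : Matrix (Fin 2) (Fin 2) ℝ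

namespace Controller

/-- The scalars `α`, `β` are positive and the gain matrices are (symmetric) positive definite. -/
structure Positive (C : Controller) : Prop where
  αl_pos : ∀ i, 0 < C.αl i
  αm_pos : ∀ i, 0 < C.αm i
  βl_pos : ∀ i, 0 < C.βl i
  βm_pos : ∀ i, 0 < C.βm i
  Rcl_pos : C.Rcl.PosDef
  Rcm_pos : C.Rcm.PosDef
  Kc_pos : C.Kc.PosDef

variable (C : Controller)

/-- `z_l(q_l, x_{c_l}) = q_l - q_* + x_{c_l}`. -/
def zl (ql xcl : Vec2) : Vec2 := ql - C.qs + xcl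

/-- `z_m(q_m, x_{c_m}) = q_m - q_* + x_{c_m}`. -/
def zm (qm xcm : Vec2) : Vec2 := qm - C.qs + xcm

/-- `Φ_l(z) = ∑ᵢ (α_{l_i} / β_{l_i}) ln (cosh (β_{l_i} zᵢ))`. -/
noncomputable def Φl (z : Vec2) : ℝ :=
  ∑ i, C.αl i / C.βl i * Real.log (Real.cosh (C.βl i * z i))

/-- `Φ_m(z) = ∑ᵢ (α_{m_i} / β_{m_i}) ln (cosh (β_{m_i} zᵢ))`. -/
noncomputable def Φm (z : Vec2) : ℝ :=
  ∑ i, C.αm i / C.βm i * Real.log (Real.cosh (C.βm i * z i))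

/-- The control law `u = -∇Φ_l(z_l) - ∇Φ_m(z_m)`, a function of the positions `q_l, q_m` and of the
controller states only. -/
noncomputable def u (ql qm xcl xcm : Vec2) : Vec2 :=
  -grad C.Φl (C.zl ql xcl) - grad C.Φm (C.zm qm xcm)

/-- The dynamics `ẋ_{c_l} = -R_{c_l} ∇_{x_{c_l}} Φ_l(z_l(q_l, x_{c_l}))`. -/
noncomputable def xclDot (ql xcl : Vec2) : Vec2 :=
  -(C.Rcl *ᵥ grad (fun x => C.Φl (C.zl ql x)) xcl)

/-- The dynamics `ẋ_{c_m} = -R_{c_m} [∇_{x_{c_m}} Φ_m(z_m(q_m, x_{c_m})) + K_c x_{c_m}]`. -/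
noncomputable def xcmDot (qm xcm : Vec2) : Vec2 :=
  -(C.Rcm *ᵥ (grad (fun x => C.Φm (C.zm qm x)) xcm + C.Kc *ᵥ xcm))

end Controller

/-! ### The closed loop -/

/-- Indices of the augmented state `ζ = (q, p, x_{c_l}, x_{c_m}) ∈ ℝ¹²`, where `q = (q_l, q_m)` and
`p = (p_l, p_m)`. -/
abbrev Idx : Type := (LM ⊕ LM) ⊕ (Fin 2 ⊕ Fin 2)

/-- The augmented state space `ℝ¹²`. -/
abbrev State : Type := Idx → ℝ

namespace State

/-- The augmented state with the given components. -/
def mk (ql qm pl pm xcl xcm : Vec2) : State :=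
  Sum.elim (Sum.elim (Sum.elim ql qm) (Sum.elim pl pm)) (Sum.elim xcl xcm)

/-- Positions. -/
def q (ζ : State) : LM → ℝ := fun i => ζ (Sum.inl (Sum.inl i))

/-- Momenta. -/
def p (ζ : State) : LM → ℝ := fun i => ζ (Sum.inl (Sum.inr i))

/-- Positions of the links. -/
def ql (ζ : State) : Vec2 := fun i => q ζ (Sum.inl i)

/-- Positions of the motors. -/
def qm (ζ : State) : Vec2 := fun i => q ζ (Sum.inr i)

/-- First controller state. -/
def xcl (ζ : State) : Vec2 := fun i => ζ (Sum.inr (Sum.inl i))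

/-- Second controller state. -/
def xcm (ζ : State) : Vec2 := fun i => ζ (Sum.inr (Sum.inr i))

end State

/-- The vector field of the closed loop: the robot with input `u`, together with the dynamics of
the controller. -/
noncomputable def closedLoop (P : Robot) (C : Controller) (ζ : State) : State :=
  Sum.elim
    (P.plant (State.q ζ) (State.p ζ)
      (C.u (State.ql ζ) (State.qm ζ) (State.xcl ζ) (State.xcm ζ)))
    (Sum.elim (C.xclDot (State.ql ζ) (State.xcl ζ)) (C.xcmDot (State.qm ζ) (State.xcm ζ)))

/-- `H_ζ = H(q, p) + Φ_l(z_l) + Φ_m(z_m) + ½ ‖x_{c_m}‖²_{K_c}`. -/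
noncomputable def Hζ (P : Robot) (C : Controller) (ζ : State) : ℝ :=
  P.H (State.q ζ) (State.p ζ) + C.Φl (C.zl (State.ql ζ) (State.xcl ζ)) +
    C.Φm (C.zm (State.qm ζ) (State.xcm ζ)) +
    (1 / 2) * (State.xcm ζ ⬝ᵥ C.Kc *ᵥ State.xcm ζ)

/-- `Γ_ζ = [I; -I]`. -/
def Γζ : Matrix LM (Fin 2) ℝ := fromRows 1 (-1)

/-- The constant matrix `F_ζ` of the port-Hamiltonian form of the closed loop. -/
noncomputable def Fζ (P : Robot) (C : Controller) : Matrix Idx Idx ℝ :=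
  fromBlocks
    (fromBlocks 0 1 (-1) (-P.R2)) (fromBlocks 0 0 Γζ 0)
    0 (fromBlocks (-C.Rcl) 0 0 (-C.Rcm))

/-- The desired equilibrium `ζ_* = (q_*, q_*, 0, 0, 0, 0)`. -/
def ζs (C : Controller) : State := State.mk C.qs C.qs 0 0 0 0

end FlexJointRobot

/-! The energy `Hζ` is the Lyapunov function. Positions and controller states enter the potentials
only through their sums `z_l`, `z_m`, so each `∇Φ` appears in `∇Hζ` both in a position block and in
a controller block. Reading `Γζ` against these two copies gives the port-Hamiltonian form
(`closedLoop_eq`). The torque bound is just `|tanh| < 1`.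

Dissipation amounts to the quadratic form of `Fζ`. Completing squares in the velocities absorbs the
cross terms from `Γζ` at the cost of `¼(D_l⁻¹ + D_m⁻¹)`, which `R_{c_l}` dominates
(`dotProduct_Fζ_mulVec`). Hence `Hζ` never increases, and it is stationary exactly when the
velocities, `∇Φ_l` and `∇Φ_m + K_c x_{c_m}` all vanish.

That set is larger than the equilibrium, so a LaSalle argument is needed. Instead of invariant limit
sets it uses Barbalat's lemma twice: the energy converges, so its derivative tends to `0` and hence
`p → 0`; then `ṗ → 0` as well. At a limit point, `ṗ_l = 0` forces `q_l = q_m`, `ṗ_m = 0` forces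
`∇Φ_m = 0`, and then `x_{c_m} = 0` and `z_l = z_m = 0`, which leaves only `ζs`
(`eq_ζs_of_fderiv_Hζ_closedLoop_eq_zero`). -/

namespace FlexJointRobot

/-! ### Barbalat's lemma -/

/-- **Barbalat's lemma**: if `φ` converges at infinity and its derivative is uniformly continuous,
then the derivative converges to `0`. -/
theorem tendsto_zero_of_uniformContinuousOn_deriv {φ φ' : ℝ → ℝ} {c : ℝ}
    (hφ : ∀ t ∈ Ici (0 : ℝ), HasDerivWithinAt φ (φ' t) (Ici 0) t)
    (hφ' : UniformContinuousOn φ' (Ici 0)) (hc : Tendsto φ atTop (𝓝 c)) :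
    Tendsto φ' atTop (𝓝 0) := by
  rw [Metric.tendsto_atTop]
  intro ε hε
  rw [Metric.uniformContinuousOn_iff] at hφ'
  obtain ⟨δ, hδ, huc⟩ := hφ' (ε / 2) (half_pos hε)
  -- The mean value theorem on a window of length `δ / 2` bounds some `|φ' s|` by `2 (ε δ / 16) / (δ
  -- / 2) = ε / 4`, and uniform continuity adds `ε / 2`.
  have hη : 0 < ε * δ / 16 := by positivity
  obtain ⟨N, hN⟩ := Metric.tendsto_atTop.1 hc (ε * δ / 16) hη
  refine ⟨max N 0, fun t ht => ?_⟩
  have ht0 : 0 ≤ t := (le_max_right _ _).trans ht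
  have htN : N ≤ t := (le_max_left _ _).trans ht
  obtain ⟨s, hs, hslope⟩ := exists_hasDerivAt_eq_slope φ φ' (show t < t + δ / 2 by linarith)
    (fun s hs => ((hφ s (ht0.trans hs.1)).continuousWithinAt).mono
      (fun r hr => ht0.trans hr.1))
    (fun s hs => (hφ s (ht0.trans hs.1.le)).hasDerivAt (Ici_mem_nhds (ht0.trans_lt hs.1)))
  have h1 := hN t htN
  have h2 := hN (t + δ / 2) (by linarith)
  have h3 := huc t ht0 s (ht0.trans hs.1.le) (by
    rw [Real.dist_eq, abs_lt]; constructor <;> linarith [hs.1, hs.2])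
  rw [Real.dist_eq, abs_lt] at h1 h2 h3
  have h4 : φ' s * (δ / 2) = φ (t + δ / 2) - φ t := by
    rw [hslope, add_sub_cancel_left]; field_simp
  rw [Real.dist_eq, sub_zero, abs_lt]
  constructor <;> nlinarith [h1.1, h1.2, h2.1, h2.2, h3.1, h3.2]

/-! ### Solutions of differential equations -/

section Flow

variable {E : Type*} [NormedAddCommGroup E] [NormedSpace ℝ E]

/-- A bounded Lipschitz vector field has solutions on `[0, ∞)`. -/
theorem exists_isIntegralCurveOn_Ici [CompleteSpace E] {g : E → E} {K L : NNReal}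
    (hK : LipschitzWith K g) (hL : ∀ x, ‖g x‖ ≤ L) (ξ : E) :
    ∃ x : ℝ → E, x 0 = ξ ∧ IsIntegralCurveOn x (fun _ => g) (Ici 0) := by
  have hloc : ∀ n : ℕ, ∃ x : ℝ → E, x 0 = ξ ∧
      ∀ t ∈ Icc (0 : ℝ) n, HasDerivWithinAt x (g (x t)) (Icc 0 n) t := by
    intro n
    -- A curve of speed at most `L` travels at most `L * n` in time `n`; a ball of that radius makes
    -- the Picard–Lindelöf condition hold on all of `[0, n]`.
    have hpl : IsPicardLindelof (fun _ : ℝ => g)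
        (⟨0, left_mem_Icc.2 n.cast_nonneg⟩ : Icc (0 : ℝ) n) ξ (L * n) 0 L K :=
      { lipschitzOnWith := fun _ _ => hK.lipschitzOnWith
        continuousOn := fun _ _ => continuousOn_const
        norm_le := fun _ _ x _ => hL x
        mul_max_le := by simp }
    exact hpl.exists_eq_forall_mem_Icc_hasDerivWithinAt₀
  choose y hy0 hy using hloc
  have hcont : ∀ n : ℕ, ContinuousOn (y n) (Icc 0 n) := fun n t ht =>
    (hy n t ht).continuousWithinAt
  have hright : ∀ n : ℕ, ∀ t ∈ Ico (0 : ℝ) n, HasDerivWithinAt (y n) (g (y n t)) (Ici t) t :=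
    fun n t ht => (hy n t (Ico_subset_Icc_self ht)).mono_of_mem_nhdsWithin
      (mem_of_superset (Icc_mem_nhdsGE ht.2) (Icc_subset_Icc_left ht.1))
  have heq : ∀ m n : ℕ, m ≤ n → EqOn (y m) (y n) (Icc 0 m) := by
    intro m n hmn
    have hmn' : (m : ℝ) ≤ n := by exact_mod_cast hmn
    exact ODE_solution_unique (v := fun _ => g) (fun _ => hK) (hcont m) (hright m)
      ((hcont n).mono (Icc_subset_Icc_right hmn'))
      (fun t ht => hright n t ⟨ht.1, ht.2.trans_le hmn'⟩) (by rw [hy0, hy0])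
  -- By uniqueness the solutions on `[0, n]` extend one another, so any index above `t` gives the
  -- same value.
  set x : ℝ → E := fun t => y (⌈t⌉₊) t with hx
  have hxy : ∀ n : ℕ, EqOn x (y n) (Icc 0 n) := fun n t ht =>
    heq _ _ (Nat.ceil_le.2 ht.2) ⟨ht.1, Nat.le_ceil t⟩
  refine ⟨x, by simp [hx, hy0], fun t ht => ?_⟩
  -- Strictness makes `[0, n]` a neighbourhood of `t` within `[0, ∞)`.
  obtain ⟨n, hn⟩ := exists_nat_gt t
  have htn : t ∈ Icc (0 : ℝ) n := ⟨ht, hn.le⟩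
  have h := (hy n t htn).congr (hxy n) (hxy n htn)
  rw [← hxy n htn] at h
  refine h.mono_of_mem_nhdsWithin ?_
  rw [← Ici_inter_Iic]
  exact inter_mem self_mem_nhdsWithin (mem_nhdsWithin_of_mem_nhds (Iic_mem_nhds hn))

theorem _root_.IsIntegralCurveOn.hasDerivWithinAt_comp {x : ℝ → E} {f : E → E} {s : Set ℝ}
    (hx : IsIntegralCurveOn x (fun _ => f) s) {V : E → ℝ} (hV : Differentiable ℝ V)
    {t : ℝ} (ht : t ∈ s) :
    HasDerivWithinAt (fun r => V (x r)) (fderiv ℝ V (x t) (f (x t))) s t :=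
  (hV (x t)).hasFDerivAt.comp_hasDerivWithinAt t (hx t ht)

theorem _root_.IsIntegralCurveOn.antitoneOn_comp {x : ℝ → E} {f : E → E} {s : Set ℝ} (hs : Convex ℝ s)
    (hx : IsIntegralCurveOn x (fun _ => f) s) {V : E → ℝ} (hV : Differentiable ℝ V)
    (hVf : ∀ y, fderiv ℝ V y (f y) ≤ 0) : AntitoneOn (fun t => V (x t)) s :=
  antitoneOn_of_hasDerivWithinAt_nonpos hs
    (fun _ ht => (hx.hasDerivWithinAt_comp hV ht).continuousWithinAt)
    (fun _ ht => (hx.hasDerivWithinAt_comp hV (interior_subset ht)).mono interior_subset)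
    (fun _ _ => hVf _)

/-- Solutions that start close to a strict minimum of a function that decreases along the vector
field stay close to it. The estimate does not depend on the vector field. -/
theorem exists_forall_mem_ball_of_lyapunov [FiniteDimensional ℝ E] {V : E → ℝ} {x₀ : E}
    (hV : Differentiable ℝ V) (hV0 : V x₀ = 0) (hpos : ∀ x, x ≠ x₀ → 0 < V x)
    {ε : ℝ} (hε : 0 < ε) :
    ∃ δ > 0, ∀ g : E → E, (∀ y, fderiv ℝ V y (g y) ≤ 0) → ∀ T : ℝ, ∀ x : ℝ → E,
      x 0 ∈ Metric.ball x₀ δ → IsIntegralCurveOn x (fun _ => g) (Ico 0 T) →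
      ∀ t ∈ Ico 0 T, x t ∈ Metric.ball x₀ ε := by
  have := FiniteDimensional.proper ℝ E
  have hm : ∃ m > 0, ∀ y ∈ Metric.sphere x₀ ε, m ≤ V y := by
    -- The sphere is empty when `E` is trivial.
    rcases (Metric.sphere x₀ ε).eq_empty_or_nonempty with h | h
    · exact ⟨1, one_pos, by simp [h]⟩
    · obtain ⟨z, hz, hmin⟩ := (isCompact_sphere x₀ ε).exists_isMinOn h hV.continuous.continuousOn
      exact ⟨V z, hpos z (Metric.ne_of_mem_sphere hz hε.ne'), hmin⟩
  obtain ⟨m, hm0, hm⟩ := hm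
  obtain ⟨δ, hδ, hball⟩ := Metric.mem_nhds_iff.1
    (hV.continuous.continuousAt.preimage_mem_nhds (t := Iio m) (x := x₀)
      (by rw [hV0]; exact Iio_mem_nhds hm0))
  refine ⟨min δ ε, lt_min hδ hε, fun g hg T x hx0 hx t ht => ?_⟩
  by_contra hcon
  rw [Metric.mem_ball, not_lt] at hcon
  have hsub : Icc 0 t ⊆ Ico 0 T := fun s hs => ⟨hs.1, hs.2.trans_lt ht.2⟩
  have hcont : ContinuousOn (fun s => dist (x s) x₀) (Icc 0 t) :=
    (continuous_id.dist continuous_const).comp_continuousOn (hx.continuousOn.mono hsub)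
  -- To leave the ball the curve must cross the sphere, where `V ≥ m`, although `V` started below
  -- `m`.
  obtain ⟨s, hs, hsε⟩ := intermediate_value_Icc ht.1 hcont
    ⟨(lt_of_lt_of_le hx0 (min_le_right _ _)).le, hcon⟩
  have hanti := hx.antitoneOn_comp (convex_Ico 0 T) hV hg ⟨le_rfl, ht.1.trans_lt ht.2⟩ (hsub hs) hs.1
  have hlt : V (x 0) < m := hball (Metric.ball_subset_ball (min_le_left _ _) hx0)
  exact (hm _ hsε).not_gt (hanti.trans_lt hlt)

/-- A vector field on a finite dimensional space with a Lyapunov function has a stable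
equilibrium. -/
theorem isStableEquilibrium_of_lyapunov [FiniteDimensional ℝ E] {f : E → E} {V : E → ℝ} {x₀ : E}
    (hf : ContDiff ℝ 1 f) (hf0 : f x₀ = 0) (hV : Differentiable ℝ V) (hV0 : V x₀ = 0)
    (hpos : ∀ x, x ≠ x₀ → 0 < V x) (hVf : ∀ y, fderiv ℝ V y (f y) ≤ 0) :
    IsStableEquilibrium f x₀ := by
  have := FiniteDimensional.proper ℝ E
  have := FiniteDimensional.complete ℝ E
  refine ⟨hf0, fun ε hε => ?_⟩
  obtain ⟨δ, hδ, hstay⟩ := exists_forall_mem_ball_of_lyapunov hV hV0 hpos hε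
  obtain ⟨δ₁, hδ₁, hstay₁⟩ := exists_forall_mem_ball_of_lyapunov hV hV0 hpos one_pos
  refine ⟨min δ δ₁, lt_min hδ hδ₁, fun ξ hξ => ⟨?_, fun T _ x hx0 hx =>
    hstay f hVf T x (hx0 ▸ Metric.ball_subset_ball (min_le_left _ _) hξ) hx⟩⟩
  -- Cutting off `f` makes it bounded and Lipschitz, hence globally solvable. Since `χ ≥ 0`, `V`
  -- still decreases along `χ • f`, so solutions starting in the `δ₁`-ball stay in the unit ball,
  -- where `χ = 1` and the two fields agree.
  let χ : ContDiffBump x₀ := ⟨1, 2, one_pos, one_lt_two⟩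
  set g : E → E := fun y => χ y • f y with hg
  have hgc : ContDiff ℝ 1 g := χ.contDiff.smul hf
  have hgs : HasCompactSupport g := χ.hasCompactSupport.smul_right
  obtain ⟨K, hK⟩ := hgc.lipschitzWith_of_hasCompactSupport hgs one_ne_zero
  obtain ⟨L, hL⟩ := hgs.exists_bound_of_continuous hgc.continuous
  obtain ⟨x, hx0, hx⟩ := exists_isIntegralCurveOn_Ici (L := L.toNNReal) hK
    (fun y => (hL y).trans (Real.le_coe_toNNReal L)) ξ
  refine ⟨x, hx0, fun t ht => ?_⟩
  have hmem : x t ∈ Metric.ball x₀ 1 :=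
    hstay₁ g (fun y => by
      simp only [hg, map_smul, smul_eq_mul]
      exact mul_nonpos_of_nonneg_of_nonpos χ.nonneg (hVf y)) (t + 1) x
      (hx0 ▸ Metric.ball_subset_ball (min_le_right _ _) hξ)
      (hx.mono Ico_subset_Ici_self) t ⟨ht, lt_add_one t⟩
  have h := hx t ht
  have hχ : χ (x t) = 1 := χ.one_of_mem_closedBall (Metric.ball_subset_closedBall hmem)
  simpa [hg, hχ] using h

/-- Along a bounded solution, the derivative of a function that converges converges to `0`. -/
theorem tendsto_fderiv_apply_zero {f : E → E} (hf : Continuous f) {x : ℝ → E}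
    (hx : IsIntegralCurveOn x (fun _ => f) (Ici 0)) {S : Set E} (hS : IsCompact S)
    (hxS : ∀ t ∈ Ici (0 : ℝ), x t ∈ S) {V : E → ℝ} (hV : ContDiff ℝ 1 V) {c : ℝ}
    (hc : Tendsto (fun t => V (x t)) atTop (𝓝 c)) :
    Tendsto (fun t => fderiv ℝ V (x t) (f (x t))) atTop (𝓝 0) := by
  refine tendsto_zero_of_uniformContinuousOn_deriv
    (fun t ht => hx.hasDerivWithinAt_comp (hV.differentiable one_ne_zero) ht) ?_ hc
  -- A bound on the speed makes the curve Lipschitz, so composing it with a function uniformly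
  -- continuous on `S` stays uniformly continuous.
  obtain ⟨C, hC⟩ := hS.exists_bound_of_continuousOn hf.continuousOn
  have hlip : LipschitzOnWith C.toNNReal x (Ici 0) :=
    (convex_Ici 0).lipschitzOnWith_of_nnnorm_hasDerivWithin_le hx
      (fun t ht => NNReal.coe_le_coe.1 ((hC _ (hxS t ht)).trans (Real.le_coe_toNNReal C)))
  have hcont : Continuous fun y => fderiv ℝ V y (f y) :=
    (hV.continuous_fderiv one_ne_zero).clm_apply hf
  exact (hS.uniformContinuousOn_of_continuous hcont.continuousOn).comp
    hlip.uniformContinuousOn hxS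

/-- A **LaSalle-type criterion**: suppose that a Lyapunov function `V` decreases along `f`, that
the linear functionals `ℓ i` vanish where `V` is stationary along `f`, and that `x₀` is the only
such point where in addition the derivatives of the `ℓ i` along `f` vanish. Then `x₀` is
asymptotically stable. -/
theorem isAsymptoticallyStable_of_lyapunov [FiniteDimensional ℝ E] {ι : Type*} {f : E → E}
    {V : E → ℝ} {x₀ : E} (hf : ContDiff ℝ 1 f) (hf0 : f x₀ = 0) (hV : ContDiff ℝ 1 V)
    (hV0 : V x₀ = 0) (hpos : ∀ x, x ≠ x₀ → 0 < V x) (hVf : ∀ y, fderiv ℝ V y (f y) ≤ 0)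
    (ℓ : ι → E →L[ℝ] ℝ) (hℓ : ∀ y, fderiv ℝ V y (f y) = 0 → ∀ i, ℓ i y = 0)
    (hlast : ∀ y, fderiv ℝ V y (f y) = 0 → (∀ i, ℓ i (f y) = 0) → y = x₀) :
    IsAsymptoticallyStable f x₀ := by
  have := FiniteDimensional.proper ℝ E
  have hVd := hV.differentiable one_ne_zero
  refine ⟨isStableEquilibrium_of_lyapunov hf hf0 hVd hV0 hpos hVf, ?_⟩
  obtain ⟨δ, hδ, hstay⟩ := exists_forall_mem_ball_of_lyapunov hVd hV0 hpos one_pos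
  refine ⟨δ, hδ, fun x hx0 hx => ?_⟩
  have hS := isCompact_closedBall x₀ (1 : ℝ)
  have hxS : ∀ t ∈ Ici (0 : ℝ), x t ∈ Metric.closedBall x₀ 1 := fun t ht =>
    Metric.ball_subset_closedBall
      (hstay f hVf (t + 1) x hx0 (hx.mono Ico_subset_Ici_self) t ⟨ht, lt_add_one t⟩)
  have hnonneg : ∀ y, 0 ≤ V y := fun y => by
    rcases eq_or_ne y x₀ with rfl | h
    exacts [hV0.ge, (hpos y h).le]
  have hanti := hx.antitoneOn_comp (convex_Ici 0) hVd hVf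
  obtain ⟨c, hc⟩ : ∃ c, Tendsto (fun t => V (x t)) atTop (𝓝 c) := by
    -- Freezing negative times gives a monotone function on all of `ℝ`.
    have h : Antitone fun t => V (x (max t 0)) := fun s t hst =>
      hanti (mem_Ici.2 (le_max_right _ _)) (mem_Ici.2 (le_max_right _ _)) (max_le_max_right 0 hst)
    refine ⟨_, (tendsto_atTop_ciInf h ⟨0, ?_⟩).congr' ?_⟩
    · rintro _ ⟨t, rfl⟩
      exact hnonneg _
    · filter_upwards [eventually_ge_atTop 0] with t ht
      rw [max_eq_left ht]
  have hW := tendsto_fderiv_apply_zero hf.continuous hx hS hxS hV hc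
  have hcontW : Continuous fun y => fderiv ℝ V y (f y) :=
    (hV.continuous_fderiv one_ne_zero).clm_apply hf.continuous
  -- Ultrafilters replace subsequences: by compactness the curve converges along each of them, to a
  -- point where `V` is stationary along `f`.
  have hcluster : ∀ u : Ultrafilter ℝ, ↑u ≤ (atTop : Filter ℝ) →
      ∃ y, fderiv ℝ V y (f y) = 0 ∧ Tendsto x u (𝓝 y) := by
    intro u hu
    obtain ⟨y, -, hy⟩ := hS.ultrafilter_le_nhds (u.map x) (by
      rw [Ultrafilter.coe_map, le_principal_iff]
      exact hu (mem_map.2 ((eventually_ge_atTop 0).mono hxS)))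
    exact ⟨y, tendsto_nhds_unique ((hcontW.tendsto y).comp hy) (hW.mono_left hu), hy⟩
  have hℓ0 : ∀ i, Tendsto (fun t => ℓ i (x t)) atTop (𝓝 0) := by
    intro i
    rw [tendsto_iff_ultrafilter]
    intro u hu
    obtain ⟨y, hy, hxy⟩ := hcluster u hu
    have := ((ℓ i).continuous.tendsto y).comp hxy
    rwa [hℓ y hy i] at this
  -- Second use of Barbalat: the derivative of `ℓ i` along the solution is `ℓ i (f (x t))`.
  have hℓf : ∀ i, Tendsto (fun t => ℓ i (f (x t))) atTop (𝓝 0) := fun i => by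
    simpa using tendsto_fderiv_apply_zero hf.continuous hx hS hxS (ℓ i).contDiff (hℓ0 i)
  rw [tendsto_iff_ultrafilter]
  intro u hu
  obtain ⟨y, hy, hxy⟩ := hcluster u hu
  have hyx : y = x₀ := hlast y hy fun i => tendsto_nhds_unique
    ((((ℓ i).continuous.comp hf.continuous).tendsto y).comp hxy) ((hℓf i).mono_left hu)
  rwa [hyx] at hxy

end Flow

/-! ### Gradients -/

section Gradient

variable {ι : Type*} [Fintype ι]

/-- Explicit gradients below are found by differentiating along coordinate lines and comparing with
this by uniqueness of derivatives. -/
theorem hasDerivAt_grad [DecidableEq ι] {f : (ι → ℝ) → ℝ} {x : ι → ℝ} (hf : DifferentiableAt ℝ f x) (i : ι) :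
    HasDerivAt (fun t : ℝ => f (x + t • Pi.single i 1)) (grad f x i) 0 :=
  hf.hasFDerivAt.hasLineDerivAt (Pi.single i 1)

theorem fderiv_apply_eq_grad_dotProduct [DecidableEq ι] (f : (ι → ℝ) → ℝ) (x v : ι → ℝ) :
    fderiv ℝ f x v = grad f x ⬝ᵥ v := by
  conv_lhs => rw [pi_eq_sum_univ' v]
  simp only [map_sum, map_smul, smul_eq_mul, dotProduct, grad, mul_comm (v _)]

theorem contDiff_grad [DecidableEq ι] {f : (ι → ℝ) → ℝ} (hf : ContDiff ℝ 2 f) : ContDiff ℝ 1 (grad f) :=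
  contDiff_pi.2 fun _ => (hf.fderiv_right (by norm_num)).clm_apply contDiff_const

theorem grad_comp_add_right [DecidableEq ι] (f : (ι → ℝ) → ℝ) (a x : ι → ℝ) :
    grad (fun y => f (a + y)) x = grad f (a + x) := by
  ext i
  simp only [grad, fderiv_comp_add_left]

/-- Symmetry of `K` merges the two cross terms, so the function is an explicit quadratic polynomial
in `t`. -/
theorem hasDerivAt_half_quadratic {K : Matrix ι ι ℝ} (hK : K.IsHermitian) (x v : ι → ℝ) :
    HasDerivAt (fun t : ℝ => (1 / 2) * ((x + t • v) ⬝ᵥ K *ᵥ (x + t • v))) (v ⬝ᵥ K *ᵥ x) 0 := by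
  have hsymm : x ⬝ᵥ K *ᵥ v = v ⬝ᵥ K *ᵥ x := by
    have hT : Kᵀ = K := by simpa using hK.eq
    rw [dotProduct_mulVec, ← mulVec_transpose, hT, dotProduct_comm]
  have heq : (fun t : ℝ => (1 / 2) * ((x + t • v) ⬝ᵥ K *ᵥ (x + t • v))) =
      fun t => (1 / 2) * (x ⬝ᵥ K *ᵥ x) + t * (v ⬝ᵥ K *ᵥ x) + t ^ 2 * ((1 / 2) * (v ⬝ᵥ K *ᵥ v)) := by
    ext t
    simp only [mulVec_add, mulVec_smul, dotProduct_add, add_dotProduct, smul_dotProduct,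
      dotProduct_smul, smul_eq_mul, hsymm]
    ring
  rw [heq]
  have h := (((hasDerivAt_id (0 : ℝ)).mul_const (v ⬝ᵥ K *ᵥ x)).const_add
    ((1 / 2) * (x ⬝ᵥ K *ᵥ x))).add
    ((hasDerivAt_pow 2 (0 : ℝ)).mul_const ((1 / 2) * (v ⬝ᵥ K *ᵥ v)))
  exact (h.congr_deriv (by simp)).congr_of_eventuallyEq (Eventually.of_forall fun t => by simp)

theorem contDiff_dotProduct_mulVec {E : Type*} [NormedAddCommGroup E] [NormedSpace ℝ E]
    {n : WithTop ℕ∞} {x : E → ι → ℝ} {K : E → Matrix ι ι ℝ} (hx : ContDiff ℝ n x)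
    (hK : ∀ i j, ContDiff ℝ n fun e => K e i j) :
    ContDiff ℝ n fun e => x e ⬝ᵥ K e *ᵥ x e := by
  simp only [dotProduct, mulVec]
  exact ContDiff.sum fun i _ => (contDiff_pi.1 hx i).mul
    (ContDiff.sum fun j _ => (hK i j).mul (contDiff_pi.1 hx j))

theorem contDiff_det [DecidableEq ι] {E : Type*} [NormedAddCommGroup E] [NormedSpace ℝ E]
    {n : WithTop ℕ∞} {A : E → Matrix ι ι ℝ} (hA : ∀ i j, ContDiff ℝ n fun e => A e i j) :
    ContDiff ℝ n fun e => (A e).det := by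
  simp only [det_apply']
  exact ContDiff.sum fun σ _ => contDiff_const.mul (contDiff_prod fun i _ => hA _ _)

/-- Cramer's rule: the entries of the adjugate are determinants of `A e` with one row replaced by a
constant one. -/
theorem contDiff_inv_apply [DecidableEq ι] {E : Type*} [NormedAddCommGroup E] [NormedSpace ℝ E]
    {n : WithTop ℕ∞} {A : E → Matrix ι ι ℝ} (hA : ∀ i j, ContDiff ℝ n fun e => A e i j)
    (hdet : ∀ e, (A e).det ≠ 0) (i j : ι) : ContDiff ℝ n fun e => (A e)⁻¹ i j := by
  simp only [inv_def, Ring.inverse_eq_inv', Matrix.smul_apply, smul_eq_mul, adjugate_apply]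
  refine ((contDiff_det hA).inv hdet).mul (contDiff_det fun k l => ?_)
  rcases eq_or_ne k j with rfl | h
  · simpa using contDiff_const
  · simpa [updateRow_ne h] using hA k l

end Gradient

/-! ### The saturated potentials -/

theorem contDiff_log_cosh {n : WithTop ℕ∞} {E : Type*} [NormedAddCommGroup E] [NormedSpace ℝ E]
    {g : E → ℝ} (hg : ContDiff ℝ n g) : ContDiff ℝ n fun e => Real.log (Real.cosh (g e)) :=
  (hg.cosh).log fun _ => (Real.cosh_pos _).ne'

theorem log_cosh_nonneg (x : ℝ) : 0 ≤ Real.log (Real.cosh x) := Real.log_nonneg (Real.one_le_cosh x)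

theorem log_cosh_eq_zero {x : ℝ} (h : Real.log (Real.cosh x) = 0) : x = 0 := by
  by_contra hx
  exact (Real.log_pos (Real.one_lt_cosh.2 hx)).ne' h

theorem eq_zero_of_mul_tanh_eq_zero {ι : Type*} {α β z : ι → ℝ} (hα : ∀ i, 0 < α i)
    (hβ : ∀ i, 0 < β i)
    (h : ∀ i, α i * Real.tanh (β i * z i) = 0) : z = 0 := by
  ext i
  have h1 := (mul_eq_zero.1 (h i)).resolve_left (hα i).ne'
  rw [Real.tanh_eq_sinh_div_cosh, div_eq_zero_iff, or_iff_left (Real.cosh_pos _).ne',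
    Real.sinh_eq_zero] at h1
  exact (mul_eq_zero.1 h1).resolve_left (hβ i).ne'

section Potential

variable {ι : Type*} [Fintype ι] {α β : ι → ℝ}

theorem contDiff_sum_log_cosh (n : WithTop ℕ∞) (α β : ι → ℝ) :
    ContDiff ℝ n fun z : ι → ℝ => ∑ i, α i / β i * Real.log (Real.cosh (β i * z i)) :=
  ContDiff.sum fun i _ =>
    contDiff_const.mul (contDiff_log_cosh (contDiff_const.mul (contDiff_apply ℝ ℝ i)))

/-- The derivative of `ln cosh` is `tanh`, and the chain rule factor `β` cancels the denominator of
`α / β`; this is the source of the saturation level `α`. -/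
theorem grad_sum_log_cosh [DecidableEq ι] (hβ : ∀ i, 0 < β i) (z : ι → ℝ) (i : ι) :
    grad (fun z : ι → ℝ => ∑ i, α i / β i * Real.log (Real.cosh (β i * z i))) z i =
      α i * Real.tanh (β i * z i) := by
  refine (hasDerivAt_grad
    ((contDiff_sum_log_cosh 1 α β).differentiable one_ne_zero z) i).unique ?_
  have h : ∀ j, HasDerivAt (fun t : ℝ =>
      α j / β j * Real.log (Real.cosh (β j * (z + t • Pi.single i 1 : ι → ℝ) j)))
      (α j * Real.tanh (β j * z j) * (Pi.single i 1 : ι → ℝ) j) 0 := by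
    intro j
    have h1 : HasDerivAt (fun t : ℝ => β j * (z + t • Pi.single i 1 : ι → ℝ) j)
        (β j * (1 * (Pi.single i 1 : ι → ℝ) j)) 0 := by
      simpa using (((hasDerivAt_id (0 : ℝ)).mul_const _).const_add (z j)).const_mul (β j)
    have h2 := ((h1.cosh).log (Real.cosh_pos _).ne').const_mul (α j / β j)
    refine h2.congr_deriv ?_
    have := (hβ j).ne'
    have := (Real.cosh_pos (β j * z j)).ne'
    simp only [zero_smul, add_zero, Real.tanh_eq_sinh_div_cosh]
    field_simp
  exact (HasDerivAt.fun_sum (u := Finset.univ) fun j _ => h j).congr_deriv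
    (by simp [Pi.single_apply])

theorem sum_log_cosh_nonneg (hα : ∀ i, 0 < α i) (hβ : ∀ i, 0 < β i) (z : ι → ℝ) :
    0 ≤ ∑ i, α i / β i * Real.log (Real.cosh (β i * z i)) :=
  Finset.sum_nonneg fun i _ => mul_nonneg (div_pos (hα i) (hβ i)).le (log_cosh_nonneg _)

theorem eq_zero_of_sum_log_cosh_eq_zero (hα : ∀ i, 0 < α i) (hβ : ∀ i, 0 < β i) {z : ι → ℝ}
    (h : ∑ i, α i / β i * Real.log (Real.cosh (β i * z i)) = 0) : z = 0 := by
  rw [Finset.sum_eq_zero_iff_of_nonneg fun i _ =>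
    mul_nonneg (div_pos (hα i) (hβ i)).le (log_cosh_nonneg _)] at h
  ext i
  have := (mul_eq_zero.1 (h i (Finset.mem_univ i))).resolve_left (div_pos (hα i) (hβ i)).ne'
  exact (mul_eq_zero.1 (log_cosh_eq_zero this)).resolve_left (hβ i).ne'

end Potential

/-! ### Gradients of the controller potentials and the torque bound. -/

namespace Controller

variable {C : Controller}

theorem grad_Φl (hC : C.Positive) (z : Vec2) (i : Fin 2) :
    grad C.Φl z i = C.αl i * Real.tanh (C.βl i * z i) := grad_sum_log_cosh hC.βl_pos z i

theorem grad_Φm (hC : C.Positive) (z : Vec2) (i : Fin 2) :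
    grad C.Φm z i = C.αm i * Real.tanh (C.βm i * z i) := grad_sum_log_cosh hC.βm_pos z i

theorem contDiff_Φl (n : WithTop ℕ∞) (C : Controller) : ContDiff ℝ n C.Φl :=
  contDiff_sum_log_cosh n _ _

theorem contDiff_Φm (n : WithTop ℕ∞) (C : Controller) : ContDiff ℝ n C.Φm :=
  contDiff_sum_log_cosh n _ _

theorem abs_u_le (hC : C.Positive) (ql qm xcl xcm : Vec2) (i : Fin 2) :
    |C.u ql qm xcl xcm i| ≤ C.αl i + C.αm i := by
  simp only [u, Pi.sub_apply, Pi.neg_apply, grad_Φl hC, grad_Φm hC]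
  have hl := abs_lt.1 (Real.abs_tanh_lt_one (C.βl i * C.zl ql xcl i))
  have hm := abs_lt.1 (Real.abs_tanh_lt_one (C.βm i * C.zm qm xcm i))
  have := hC.αl_pos i
  have := hC.αm_pos i
  rw [abs_le]
  constructor <;> nlinarith

end Controller

/-! ### The energy of the robot -/

namespace Robot

variable {P : Robot}

theorem M_posDef (hP : P.Positive) (hM : ∀ θ, (P.Ml θ).PosDef) (θ : ℝ) : (P.M θ).PosDef := by
  have hD : (diagonal P.Im).PosDef := PosDef.diagonal hP.Im_pos
  refine PosDef.of_dotProduct_mulVec_pos ((hM θ).1.fromBlocks (by simp) hD.1) fun x hx => ?_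
  obtain ⟨y, z, rfl⟩ : ∃ y z, x = Sum.elim y z := ⟨_, _, (Sum.elim_comp_inl_inr x).symm⟩
  have hy := (hM θ).posSemidef.dotProduct_mulVec_nonneg y
  have hz := hD.posSemidef.dotProduct_mulVec_nonneg z
  simp only [M, star_trivial, fromBlocks_mulVec, Sum.elim_comp_inl, Sum.elim_comp_inr,
    zero_mulVec, add_zero, zero_add, sumElim_dotProduct_sumElim] at hy hz ⊢
  by_cases hy0 : y = 0
  · have hz0 : z ≠ 0 := by
      rintro rfl
      exact hx (by rw [hy0]; ext (i | i) <;> rfl)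
    have := hD.dotProduct_mulVec_pos hz0
    rw [star_trivial] at this
    linarith
  · have := (hM θ).dotProduct_mulVec_pos hy0
    rw [star_trivial] at this
    linarith

theorem contDiff_M_apply (n : WithTop ℕ∞) (P : Robot) (i j : LM) :
    ContDiff ℝ n fun θ => P.M θ i j := by
  rcases i with i | i <;> rcases j with j | j <;> simp only [M, fromBlocks_apply₁₁,
    fromBlocks_apply₁₂, fromBlocks_apply₂₁, fromBlocks_apply₂₂]
  · fin_cases i <;> fin_cases j <;> simp [Ml] <;> fun_prop
  all_goals exact contDiff_const

theorem contDiff_H (n : WithTop ℕ∞) (hP : P.Positive) (hM : ∀ θ, (P.Ml θ).PosDef)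
    {E : Type*} [NormedAddCommGroup E] [NormedSpace ℝ E] {q p : E → LM → ℝ}
    (hq : ContDiff ℝ n q) (hp : ContDiff ℝ n p) : ContDiff ℝ n fun e => P.H (q e) (p e) := by
  have hinv := contDiff_inv_apply (contDiff_M_apply n P) fun θ => (M_posDef hP hM θ).det_pos.ne'
  refine (contDiff_const.mul (contDiff_dotProduct_mulVec hp fun i j =>
    (hinv i j).comp (contDiff_pi.1 hq _))).add
    (contDiff_const.mul (contDiff_dotProduct_mulVec ?_ fun i j => contDiff_const))
  exact contDiff_pi.2 fun i => (contDiff_pi.1 hq (Sum.inl i)).sub (contDiff_pi.1 hq (Sum.inr i))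

theorem Ks_posDef (hP : P.Positive) : P.Ks.PosDef := PosDef.diagonal hP.ks_pos

theorem grad_H_momentum (hP : P.Positive) (hM : ∀ θ, (P.Ml θ).PosDef) (q p : LM → ℝ) :
    grad (fun p' => P.H q p') p = (P.M (q (Sum.inl 1)))⁻¹ *ᵥ p := by
  ext i
  refine (hasDerivAt_grad ((contDiff_H 1 hP hM contDiff_const contDiff_id).differentiable
    one_ne_zero p) i).unique ?_
  exact ((hasDerivAt_half_quadratic (M_posDef hP hM (q (Sum.inl 1))).inv.1 p
    (Pi.single i 1)).add_const _).congr_deriv (single_one_dotProduct _ _)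

/-- With zero momentum the kinetic energy vanishes for every `q`, so the dependence of the inertia
on `q` plays no role and only the spring force remains. The stability argument needs no other case.
-/
theorem grad_H_position_of_momentum_eq_zero (hP : P.Positive) (hM : ∀ θ, (P.Ml θ).PosDef)
    (q : LM → ℝ) : grad (fun q' => P.H q' 0) q =
      Sum.elim (P.Ks *ᵥ (q ∘ Sum.inl - q ∘ Sum.inr)) (-(P.Ks *ᵥ (q ∘ Sum.inl - q ∘ Sum.inr))) := by
  ext i
  refine (hasDerivAt_grad ((contDiff_H 1 hP hM contDiff_id contDiff_const).differentiable
    one_ne_zero q) i).unique ?_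
  rcases i with i | i
  · have h := hasDerivAt_half_quadratic (Ks_posDef hP).1 (q ∘ Sum.inl - q ∘ Sum.inr)
      (Pi.single i 1)
    simp only [single_one_dotProduct] at h
    refine h.congr_of_eventuallyEq (Eventually.of_forall fun t => ?_)
    have : (q + t • Pi.single (Sum.inl i) 1) ∘ Sum.inl - (q + t • Pi.single (Sum.inl i) 1) ∘ Sum.inr
        = q ∘ Sum.inl - q ∘ Sum.inr + t • (Pi.single i 1 : Vec2) := by
      ext j
      simp [Pi.single_apply]
      ring
    simp [H, this]
  · have h := hasDerivAt_half_quadratic (Ks_posDef hP).1 (q ∘ Sum.inl - q ∘ Sum.inr)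
      (-Pi.single i 1)
    simp only [neg_dotProduct, single_one_dotProduct] at h
    refine h.congr_of_eventuallyEq (Eventually.of_forall fun t => ?_)
    have : (q + t • Pi.single (Sum.inr i) 1) ∘ Sum.inl - (q + t • Pi.single (Sum.inr i) 1) ∘ Sum.inr
        = q ∘ Sum.inl - q ∘ Sum.inr + t • (-Pi.single i 1 : Vec2) := by
      ext j
      simp [Pi.single_apply]
      ring
    simp [H, this]

theorem H_nonneg (hP : P.Positive) (hM : ∀ θ, (P.Ml θ).PosDef) (q p : LM → ℝ) : 0 ≤ P.H q p := by
  have h1 := (M_posDef hP hM (q (Sum.inl 1))).inv.posSemidef.dotProduct_mulVec_nonneg p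
  have h2 := (Ks_posDef hP).posSemidef.dotProduct_mulVec_nonneg (q ∘ Sum.inl - q ∘ Sum.inr)
  rw [star_trivial] at h1 h2
  unfold H
  linarith

theorem eq_of_H_eq_zero (hP : P.Positive) (hM : ∀ θ, (P.Ml θ).PosDef) {q p : LM → ℝ}
    (h : P.H q p = 0) : p = 0 ∧ q ∘ Sum.inl = q ∘ Sum.inr := by
  have hMi := (M_posDef hP hM (q (Sum.inl 1))).inv
  have h1 := hMi.posSemidef.dotProduct_mulVec_nonneg p
  have h2 := (Ks_posDef hP).posSemidef.dotProduct_mulVec_nonneg (q ∘ Sum.inl - q ∘ Sum.inr)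
  constructor
  · by_contra hp
    have h3 := hMi.dotProduct_mulVec_pos hp
    rw [star_trivial] at h2 h3
    unfold H at h
    linarith
  · by_contra hq
    have h3 := (Ks_posDef hP).dotProduct_mulVec_pos (sub_ne_zero.2 hq)
    rw [star_trivial] at h1 h3
    unfold H at h
    linarith

end Robot

/-! ### The energy of the closed loop -/

namespace State

theorem contDiff_q (n : WithTop ℕ∞) : ContDiff ℝ n q := contDiff_pi.2 fun _ => contDiff_apply ℝ ℝ _

theorem contDiff_p (n : WithTop ℕ∞) : ContDiff ℝ n p := contDiff_pi.2 fun _ => contDiff_apply ℝ ℝ _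

theorem contDiff_ql (n : WithTop ℕ∞) : ContDiff ℝ n ql :=
  contDiff_pi.2 fun _ => contDiff_apply ℝ ℝ _

theorem contDiff_qm (n : WithTop ℕ∞) : ContDiff ℝ n qm :=
  contDiff_pi.2 fun _ => contDiff_apply ℝ ℝ _

theorem contDiff_xcl (n : WithTop ℕ∞) : ContDiff ℝ n xcl :=
  contDiff_pi.2 fun _ => contDiff_apply ℝ ℝ _

theorem contDiff_xcm (n : WithTop ℕ∞) : ContDiff ℝ n xcm :=
  contDiff_pi.2 fun _ => contDiff_apply ℝ ℝ _

/-- The conditions unwind in order: `z_m = 0` fixes `q_m`, equality of positions fixes `q_l`, and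
`z_l = 0` then fixes `x_{c_l}`. -/
theorem eq_ζs {C : Controller} {ζ : State} (hp : p ζ = 0) (hq : ql ζ = qm ζ)
    (hxcm : xcm ζ = 0) (hzl : C.zl (ql ζ) (xcl ζ) = 0) (hzm : C.zm (qm ζ) (xcm ζ) = 0) :
    ζ = ζs C := by
  have hqm : qm ζ = C.qs := by
    rw [hxcm, Controller.zm, add_zero] at hzm
    exact sub_eq_zero.1 hzm
  have hxcl : xcl ζ = 0 := by
    rwa [hq, hqm, Controller.zl, sub_self, zero_add] at hzl
  ext i
  rcases i with ((i | i) | (i | i)) | (i | i)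
  · exact (congrFun hq i).trans (congrFun hqm i)
  · exact congrFun hqm i
  · exact congrFun hp (Sum.inl i)
  · exact congrFun hp (Sum.inr i)
  · exact congrFun hxcl i
  · exact congrFun hxcm i

end State

variable {P : Robot} {C : Controller}

theorem contDiff_Hζ (n : WithTop ℕ∞) (hP : P.Positive) (hM : ∀ θ, (P.Ml θ).PosDef) :
    ContDiff ℝ n (Hζ P C) := by
  refine (((Robot.contDiff_H n hP hM (State.contDiff_q n) (State.contDiff_p n)).add
    ((C.contDiff_Φl n).comp ?_)).add ((C.contDiff_Φm n).comp ?_)).add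
    (contDiff_const.mul (contDiff_dotProduct_mulVec (State.contDiff_xcm n)
      fun _ _ => contDiff_const))
  · exact ((State.contDiff_ql n).sub contDiff_const).add (State.contDiff_xcl n)
  · exact ((State.contDiff_qm n).sub contDiff_const).add (State.contDiff_xcm n)

/-- The gradient of the energy of the closed loop, in terms of its blocks. -/
theorem grad_Hζ (hP : P.Positive) (hM : ∀ θ, (P.Ml θ).PosDef) (hC : C.Positive) (ζ : State) :
    grad (Hζ P C) ζ = Sum.elim
      (Sum.elim
        (grad (fun q => P.H q (State.p ζ)) (State.q ζ) +
          Sum.elim (grad C.Φl (C.zl (State.ql ζ) (State.xcl ζ)))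
            (grad C.Φm (C.zm (State.qm ζ) (State.xcm ζ))))
        (grad (fun p => P.H (State.q ζ) p) (State.p ζ)))
      (Sum.elim (grad C.Φl (C.zl (State.ql ζ) (State.xcl ζ)))
        (grad C.Φm (C.zm (State.qm ζ) (State.xcm ζ)) + C.Kc *ᵥ State.xcm ζ)) := by
  have hHq := (Robot.contDiff_H 1 hP hM (contDiff_id (E := LM → ℝ))
    (contDiff_const (c := State.p ζ))).differentiable one_ne_zero (State.q ζ)
  have hHp := (Robot.contDiff_H 1 hP hM (contDiff_const (c := State.q ζ))
    (contDiff_id (E := LM → ℝ))).differentiable one_ne_zero (State.p ζ)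
  have hl := (C.contDiff_Φl 1).differentiable one_ne_zero (C.zl (State.ql ζ) (State.xcl ζ))
  have hm := (C.contDiff_Φm 1).differentiable one_ne_zero (C.zm (State.qm ζ) (State.xcm ζ))
  have hK := hasDerivAt_half_quadratic hC.Kc_pos.1 (State.xcm ζ)
  simp only [id] at hHq hHp
  ext k
  refine (hasDerivAt_grad ((contDiff_Hζ 1 hP hM).differentiable one_ne_zero ζ) k).unique ?_
  rcases k with (k | k) | (k | k)
  -- Along a position line only `q` and one of `z_l`, `z_m` move; all other terms are constant in
  -- `t`.
  · have hq : ∀ t : ℝ, State.q (ζ + t • Pi.single (Sum.inl (Sum.inl k)) 1) =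
        State.q ζ + t • Pi.single k 1 := fun t => by
      ext j; simp [State.q, Pi.single_apply]
    have hp : ∀ t : ℝ, State.p (ζ + t • Pi.single (Sum.inl (Sum.inl k)) 1) = State.p ζ :=
      fun t => by ext j; simp [State.p]
    have hxl : ∀ t : ℝ, State.xcl (ζ + t • Pi.single (Sum.inl (Sum.inl k)) 1) = State.xcl ζ :=
      fun t => by ext j; simp [State.xcl]
    have hxm : ∀ t : ℝ, State.xcm (ζ + t • Pi.single (Sum.inl (Sum.inl k)) 1) = State.xcm ζ :=
      fun t => by ext j; simp [State.xcm]
    rcases k with k | k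
    · have hzl : ∀ t : ℝ, C.zl (State.ql (ζ + t • Pi.single (Sum.inl (Sum.inl (Sum.inl k))) 1))
          (State.xcl ζ) = C.zl (State.ql ζ) (State.xcl ζ) + t • Pi.single k 1 := fun t => by
        ext j; simp [Controller.zl, State.ql, State.q, Pi.single_apply]; ring
      have hqm : ∀ t : ℝ, State.qm (ζ + t • Pi.single (Sum.inl (Sum.inl (Sum.inl k))) 1) =
          State.qm ζ := fun t => by ext j; simp [State.qm, State.q]
      simp only [Hζ, hq, hp, hxl, hxm, hzl, hqm]
      exact (((hasDerivAt_grad hHq _).add (hasDerivAt_grad hl k)).add_const _).add_const _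
    · have hzm : ∀ t : ℝ, C.zm (State.qm (ζ + t • Pi.single (Sum.inl (Sum.inl (Sum.inr k))) 1))
          (State.xcm ζ) = C.zm (State.qm ζ) (State.xcm ζ) + t • Pi.single k 1 := fun t => by
        ext j; simp [Controller.zm, State.qm, State.q, Pi.single_apply]; ring
      have hql : ∀ t : ℝ, State.ql (ζ + t • Pi.single (Sum.inl (Sum.inl (Sum.inr k))) 1) =
          State.ql ζ := fun t => by ext j; simp [State.ql, State.q]
      simp only [Hζ, hq, hp, hxl, hxm, hzm, hql]
      exact (((hasDerivAt_grad hHq _).add_const _).add (hasDerivAt_grad hm k)).add_const _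
  · have hq : ∀ t : ℝ, State.q (ζ + t • Pi.single (Sum.inl (Sum.inr k)) 1) = State.q ζ :=
      fun t => by ext j; simp [State.q]
    have hp : ∀ t : ℝ, State.p (ζ + t • Pi.single (Sum.inl (Sum.inr k)) 1) =
        State.p ζ + t • Pi.single k 1 := fun t => by
      ext j; simp [State.p, Pi.single_apply]
    have hxl : ∀ t : ℝ, State.xcl (ζ + t • Pi.single (Sum.inl (Sum.inr k)) 1) = State.xcl ζ :=
      fun t => by ext j; simp [State.xcl]
    have hxm : ∀ t : ℝ, State.xcm (ζ + t • Pi.single (Sum.inl (Sum.inr k)) 1) = State.xcm ζ :=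
      fun t => by ext j; simp [State.xcm]
    have hql : ∀ t : ℝ, State.ql (ζ + t • Pi.single (Sum.inl (Sum.inr k)) 1) = State.ql ζ :=
      fun t => funext fun i => congrFun (hq t) (Sum.inl i)
    have hqm : ∀ t : ℝ, State.qm (ζ + t • Pi.single (Sum.inl (Sum.inr k)) 1) = State.qm ζ :=
      fun t => funext fun i => congrFun (hq t) (Sum.inr i)
    simp only [Hζ, hql, hqm, hq, hp, hxl, hxm]
    exact (((hasDerivAt_grad hHp k).add_const _).add_const _).add_const _
  -- The state `x_{c_l}` enters only through `z_l`, with the same unit direction as `q_l`.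
  · have hq : ∀ t : ℝ, State.q (ζ + t • Pi.single (Sum.inr (Sum.inl k)) 1) = State.q ζ :=
      fun t => by ext j; simp [State.q]
    have hp : ∀ t : ℝ, State.p (ζ + t • Pi.single (Sum.inr (Sum.inl k)) 1) = State.p ζ :=
      fun t => by ext j; simp [State.p]
    have hxm : ∀ t : ℝ, State.xcm (ζ + t • Pi.single (Sum.inr (Sum.inl k)) 1) = State.xcm ζ :=
      fun t => by ext j; simp [State.xcm]
    have hzl : ∀ t : ℝ, C.zl (State.ql ζ)
        (State.xcl (ζ + t • Pi.single (Sum.inr (Sum.inl k)) 1)) =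
        C.zl (State.ql ζ) (State.xcl ζ) + t • Pi.single k 1 := fun t => by
      ext j; simp [Controller.zl, State.ql, State.xcl, Pi.single_apply]; ring
    have hql : ∀ t : ℝ, State.ql (ζ + t • Pi.single (Sum.inr (Sum.inl k)) 1) = State.ql ζ :=
      fun t => funext fun i => congrFun (hq t) (Sum.inl i)
    have hqm : ∀ t : ℝ, State.qm (ζ + t • Pi.single (Sum.inr (Sum.inl k)) 1) = State.qm ζ :=
      fun t => funext fun i => congrFun (hq t) (Sum.inr i)
    simp only [Hζ, hql, hqm, hq, hp, hxm, hzl]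
    exact (((hasDerivAt_grad hl k).const_add _).add_const _).add_const _
  · have hq : ∀ t : ℝ, State.q (ζ + t • Pi.single (Sum.inr (Sum.inr k)) 1) = State.q ζ :=
      fun t => by ext j; simp [State.q]
    have hp : ∀ t : ℝ, State.p (ζ + t • Pi.single (Sum.inr (Sum.inr k)) 1) = State.p ζ :=
      fun t => by ext j; simp [State.p]
    have hxl : ∀ t : ℝ, State.xcl (ζ + t • Pi.single (Sum.inr (Sum.inr k)) 1) = State.xcl ζ :=
      fun t => by ext j; simp [State.xcl]
    have hxm : ∀ t : ℝ, State.xcm (ζ + t • Pi.single (Sum.inr (Sum.inr k)) 1) =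
        State.xcm ζ + t • Pi.single k 1 := fun t => by
      ext j; simp [State.xcm, Pi.single_apply]
    have hzm : ∀ t : ℝ, C.zm (State.qm ζ) (State.xcm ζ + t • Pi.single k 1) =
        C.zm (State.qm ζ) (State.xcm ζ) + t • Pi.single k 1 := fun t => (add_assoc _ _ _).symm
    have hql : ∀ t : ℝ, State.ql (ζ + t • Pi.single (Sum.inr (Sum.inr k)) 1) = State.ql ζ :=
      fun t => funext fun i => congrFun (hq t) (Sum.inl i)
    have hqm : ∀ t : ℝ, State.qm (ζ + t • Pi.single (Sum.inr (Sum.inr k)) 1) = State.qm ζ :=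
      fun t => funext fun i => congrFun (hq t) (Sum.inr i)
    simp only [Hζ, hql, hqm, hq, hp, hxl, hxm, hzm]
    exact (((hasDerivAt_grad hm k).const_add _).add (hK (Pi.single k 1))).congr_deriv
      (congrArg _ (single_one_dotProduct _ _))

/-- On the unactuated link rows, `Γζ` cancels the `∇Φ_l` contained in `∇_q Hζ`. On the motor rows it
supplies `-∇Φ_l`, and `-∇_q Hζ` already contains `-∇Φ_m`: together these are `u`. -/
theorem closedLoop_eq (hP : P.Positive) (hM : ∀ θ, (P.Ml θ).PosDef) (hC : C.Positive)
    (ζ : State) : closedLoop P C ζ = Fζ P C *ᵥ grad (Hζ P C) ζ := by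
  have hl : grad (fun x => C.Φl (C.zl (State.ql ζ) x)) (State.xcl ζ) =
      grad C.Φl (C.zl (State.ql ζ) (State.xcl ζ)) := grad_comp_add_right C.Φl _ _
  have hm : grad (fun x => C.Φm (C.zm (State.qm ζ) x)) (State.xcm ζ) =
      grad C.Φm (C.zm (State.qm ζ) (State.xcm ζ)) := grad_comp_add_right C.Φm _ _
  rw [grad_Hζ hP hM hC]
  simp only [closedLoop, Robot.plant, Controller.xclDot, Controller.xcmDot, hl, hm, Fζ,
    fromBlocks_mulVec, Sum.elim_comp_inl, Sum.elim_comp_inr, Controller.u, Robot.B, Γζ,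
    fromRows_mulVec]
  ext k
  rcases k with (k | k | k) | (k | k) <;> simp [neg_mulVec] <;> ring

/-! ### Dissipation -/

theorem Fζ_mulVec (a b : LM → ℝ) (c d : Vec2) :
    Fζ P C *ᵥ Sum.elim (Sum.elim a b) (Sum.elim c d) =
      Sum.elim (Sum.elim b (-a - P.R2 *ᵥ b + Γζ *ᵥ c)) (Sum.elim (-(C.Rcl *ᵥ c)) (-(C.Rcm *ᵥ d))) := by
  simp only [Fζ, fromBlocks_mulVec, Sum.elim_comp_inl, Sum.elim_comp_inr]
  ext k
  rcases k with (k | k) | (k | k) <;> simp [neg_mulVec]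
  ring

/-- The dissipated power, as a sum of nonnegative terms. -/
theorem dotProduct_Fζ_mulVec (hP : P.Positive) (a b : LM → ℝ) (c d : Vec2) :
    Sum.elim (Sum.elim a b) (Sum.elim c d) ⬝ᵥ
        Fζ P C *ᵥ Sum.elim (Sum.elim a b) (Sum.elim c d) =
      -(∑ i, P.Dl i * (b (Sum.inl i) - c i / (2 * P.Dl i)) ^ 2 +
        ∑ i, P.Dm i * (b (Sum.inr i) + c i / (2 * P.Dm i)) ^ 2 +
        c ⬝ᵥ (C.Rcl - (1 / 4 : ℝ) • ((diagonal P.Dl)⁻¹ + (diagonal P.Dm)⁻¹)) *ᵥ c +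
        d ⬝ᵥ C.Rcm *ᵥ d) := by
  have hDl : ∀ i, P.Dl i ≠ 0 := fun i => (hP.Dl_pos i).ne'
  have hDm : ∀ i, P.Dm i ≠ 0 := fun i => (hP.Dm_pos i).ne'
  have hinv : ∀ v : Vec2, (∀ i, v i ≠ 0) → (diagonal v)⁻¹ = diagonal fun i => (v i)⁻¹ := by
    intro v hv
    refine inv_eq_right_inv ?_
    rw [diagonal_mul_diagonal, ← diagonal_one]
    congr 1
    ext i
    exact mul_inv_cancel₀ (hv i)
  rw [Fζ_mulVec, hinv _ hDl, hinv _ hDm, sub_mulVec, dotProduct_sub, sumElim_dotProduct_sumElim,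
    sumElim_dotProduct_sumElim, sumElim_dotProduct_sumElim, dotProduct_neg, dotProduct_neg]
  have h0l := hDl 0
  have h1l := hDl 1
  have h0m := hDm 0
  have h1m := hDm 1
  -- The `a`–`b` terms cancel by skew-symmetry. The cross terms `b_l · c` and `-b_m · c` are
  -- completed to squares, leaving `c_i² / (4 D_i)` for links and motors, which the matrix in `c`
  -- accounts for.
  simp only [smul_mulVec, add_mulVec, Robot.R2, Γζ, fromBlocks_mulVec, fromRows_mulVec,
    dotProduct, Fintype.sum_sum_type, Fin.sum_univ_two, Pi.add_apply, Pi.sub_apply, Pi.neg_apply,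
    Pi.smul_apply, smul_eq_mul, Sum.elim_inl, Sum.elim_inr, mulVec_diagonal, zero_mulVec,
    neg_mulVec, one_mulVec, Function.comp_apply, Pi.zero_apply]
  field_simp
  ring

section Dissipation

variable (hP : P.Positive) (hC : C.Positive)
  (hR : (C.Rcl - (1 / 4 : ℝ) • ((diagonal P.Dl)⁻¹ + (diagonal P.Dm)⁻¹)).PosDef)

include hP hC hR

theorem dotProduct_Fζ_mulVec_nonpos (w : State) : w ⬝ᵥ Fζ P C *ᵥ w ≤ 0 := by
  obtain ⟨a, b, c, d, rfl⟩ : ∃ a b c d, w = Sum.elim (Sum.elim a b) (Sum.elim c d) :=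
    ⟨State.q w, State.p w, State.xcl w, State.xcm w, by ext ((_ | _) | (_ | _)) <;> rfl⟩
  have h1 := hR.posSemidef.dotProduct_mulVec_nonneg c
  have h2 := hC.Rcm_pos.posSemidef.dotProduct_mulVec_nonneg d
  rw [star_trivial] at h1 h2
  rw [dotProduct_Fζ_mulVec hP, neg_nonpos]
  have h3 : 0 ≤ ∑ i, P.Dl i * (b (Sum.inl i) - c i / (2 * P.Dl i)) ^ 2 :=
    Finset.sum_nonneg fun i _ => mul_nonneg (hP.Dl_pos i).le (sq_nonneg _)
  have h4 : 0 ≤ ∑ i, P.Dm i * (b (Sum.inr i) + c i / (2 * P.Dm i)) ^ 2 :=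
    Finset.sum_nonneg fun i _ => mul_nonneg (hP.Dm_pos i).le (sq_nonneg _)
  positivity

theorem eq_zero_of_dotProduct_Fζ_mulVec_eq_zero {a b : LM → ℝ} {c d : Vec2}
    (h : Sum.elim (Sum.elim a b) (Sum.elim c d) ⬝ᵥ
      Fζ P C *ᵥ Sum.elim (Sum.elim a b) (Sum.elim c d) = 0) : b = 0 ∧ c = 0 ∧ d = 0 := by
  have h1 := hR.posSemidef.dotProduct_mulVec_nonneg c
  have h2 := hC.Rcm_pos.posSemidef.dotProduct_mulVec_nonneg d
  rw [star_trivial] at h1 h2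
  rw [dotProduct_Fζ_mulVec hP, neg_eq_zero] at h
  have h3' : ∀ i ∈ Finset.univ, 0 ≤ P.Dl i * (b (Sum.inl i) - c i / (2 * P.Dl i)) ^ 2 :=
    fun i _ => mul_nonneg (hP.Dl_pos i).le (sq_nonneg _)
  have h4' : ∀ i ∈ Finset.univ, 0 ≤ P.Dm i * (b (Sum.inr i) + c i / (2 * P.Dm i)) ^ 2 :=
    fun i _ => mul_nonneg (hP.Dm_pos i).le (sq_nonneg _)
  have h3 := Finset.sum_nonneg h3'
  have h4 := Finset.sum_nonneg h4'
  have hc : c = 0 := by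
    by_contra hc
    have := hR.dotProduct_mulVec_pos hc
    rw [star_trivial] at this
    linarith
  have hd : d = 0 := by
    by_contra hd
    have := hC.Rcm_pos.dotProduct_mulVec_pos hd
    rw [star_trivial] at this
    linarith
  refine ⟨?_, hc, hd⟩
  have h5 := (Finset.sum_eq_zero_iff_of_nonneg h3').1 (by linarith)
  have h6 := (Finset.sum_eq_zero_iff_of_nonneg h4').1 (by linarith)
  ext (i | i)
  · simpa [hc, (hP.Dl_pos i).ne'] using h5 i (Finset.mem_univ i)
  · simpa [hc, (hP.Dm_pos i).ne'] using h6 i (Finset.mem_univ i)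

/-- A matrix and its symmetric part have the same quadratic form. -/
theorem neg_symPart_Fζ_posSemidef : (-symPart (Fζ P C)).PosSemidef := by
  refine PosSemidef.of_dotProduct_mulVec_nonneg ?_ fun w => ?_
  · refine IsHermitian.neg ?_
    rw [IsHermitian, symPart, conjTranspose_eq_transpose_of_trivial, transpose_smul, transpose_add,
      transpose_transpose, add_comm]
  · have h := dotProduct_Fζ_mulVec_nonpos hP hC hR w
    have hT : w ⬝ᵥ (Fζ P C)ᵀ *ᵥ w = w ⬝ᵥ Fζ P C *ᵥ w := by
      rw [mulVec_transpose, dotProduct_comm, dotProduct_mulVec]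
    rw [star_trivial, symPart, neg_mulVec, dotProduct_neg, smul_mulVec, dotProduct_smul,
      add_mulVec, dotProduct_add, hT, smul_eq_mul]
    linarith

end Dissipation

/-! ### Stability of the closed loop -/

theorem Hζ_ζs (P : Robot) (C : Controller) : Hζ P C (ζs C) = 0 := by
  have hp : State.p (ζs C) = 0 := by ext (i | i) <;> rfl
  have hxl : State.xcl (ζs C) = 0 := rfl
  have hxm : State.xcm (ζs C) = 0 := rfl
  have hql : State.ql (ζs C) = C.qs := rfl
  have hqm : State.qm (ζs C) = C.qs := rfl
  have hq : State.q (ζs C) ∘ Sum.inl - State.q (ζs C) ∘ Sum.inr = 0 := sub_self C.qs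
  simp [Hζ, Robot.H, hp, hxl, hxm, hql, hqm, hq, Controller.zl, Controller.zm, Controller.Φl,
    Controller.Φm]

/-- `Hζ` is a sum of nonnegative terms; if it vanishes, so does each of them, and `State.eq_ζs`
applies. -/
theorem Hζ_pos (hP : P.Positive) (hM : ∀ θ, (P.Ml θ).PosDef) (hC : C.Positive) {ζ : State}
    (hζ : ζ ≠ ζs C) : 0 < Hζ P C ζ := by
  have h1 := Robot.H_nonneg hP hM (State.q ζ) (State.p ζ)
  have h2 : 0 ≤ C.Φl (C.zl (State.ql ζ) (State.xcl ζ)) :=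
    sum_log_cosh_nonneg hC.αl_pos hC.βl_pos _
  have h3 : 0 ≤ C.Φm (C.zm (State.qm ζ) (State.xcm ζ)) :=
    sum_log_cosh_nonneg hC.αm_pos hC.βm_pos _
  have h4 := hC.Kc_pos.posSemidef.dotProduct_mulVec_nonneg (State.xcm ζ)
  rw [star_trivial] at h4
  by_contra hneg
  rw [not_lt, Hζ] at hneg
  obtain ⟨hp, hq⟩ := Robot.eq_of_H_eq_zero hP hM (le_antisymm (by linarith) h1)
  have hl : C.Φl (C.zl (State.ql ζ) (State.xcl ζ)) = 0 := by linarith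
  have hm : C.Φm (C.zm (State.qm ζ) (State.xcm ζ)) = 0 := by linarith
  refine hζ (State.eq_ζs hp hq ?_
    (eq_zero_of_sum_log_cosh_eq_zero hC.αl_pos hC.βl_pos hl)
    (eq_zero_of_sum_log_cosh_eq_zero hC.αm_pos hC.βm_pos hm))
  by_contra hx
  have := hC.Kc_pos.dotProduct_mulVec_pos hx
  rw [star_trivial] at this
  linarith

theorem fderiv_Hζ_closedLoop (hP : P.Positive) (hM : ∀ θ, (P.Ml θ).PosDef) (hC : C.Positive)
    (ζ : State) : fderiv ℝ (Hζ P C) ζ (closedLoop P C ζ) =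
      grad (Hζ P C) ζ ⬝ᵥ Fζ P C *ᵥ grad (Hζ P C) ζ := by
  rw [fderiv_apply_eq_grad_dotProduct, closedLoop_eq hP hM hC]

/-- The port-Hamiltonian form makes the vector field a constant matrix applied to the gradient of a
`C²` function. -/
theorem contDiff_closedLoop (hP : P.Positive) (hM : ∀ θ, (P.Ml θ).PosDef) (hC : C.Positive) :
    ContDiff ℝ 1 (closedLoop P C) := by
  rw [show closedLoop P C = fun ζ => Fζ P C *ᵥ grad (Hζ P C) ζ from
    funext (closedLoop_eq hP hM hC)]
  exact (mulVecLin (Fζ P C)).toContinuousLinearMap.contDiff.comp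
    (contDiff_grad (contDiff_Hζ 2 hP hM))

/-- The energy has a minimum at `ζs`, so its gradient vanishes there. -/
theorem closedLoop_ζs (hP : P.Positive) (hM : ∀ θ, (P.Ml θ).PosDef) (hC : C.Positive) :
    closedLoop P C (ζs C) = 0 := by
  have hmin : IsLocalMin (Hζ P C) (ζs C) := Eventually.of_forall fun ζ => by
    rcases eq_or_ne ζ (ζs C) with rfl | h
    · exact le_rfl
    · exact (Hζ_ζs P C).trans_le (Hζ_pos hP hM hC h).le
  have hgrad : grad (Hζ P C) (ζs C) = 0 := by
    ext i
    simp [grad, hmin.fderiv_eq_zero]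
  rw [closedLoop_eq hP hM hC, hgrad, mulVec_zero]

section Stability

variable (hP : P.Positive) (hM : ∀ θ, (P.Ml θ).PosDef) (hC : C.Positive)
  (hR : (C.Rcl - (1 / 4 : ℝ) • ((diagonal P.Dl)⁻¹ + (diagonal P.Dm)⁻¹)).PosDef)

include hP hM hC hR

theorem fderiv_Hζ_closedLoop_nonpos (ζ : State) :
    fderiv ℝ (Hζ P C) ζ (closedLoop P C ζ) ≤ 0 := by
  rw [fderiv_Hζ_closedLoop hP hM hC]
  exact dotProduct_Fζ_mulVec_nonpos hP hC hR _

theorem of_fderiv_Hζ_closedLoop_eq_zero {ζ : State}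
    (h : fderiv ℝ (Hζ P C) ζ (closedLoop P C ζ) = 0) :
    State.p ζ = 0 ∧ grad C.Φl (C.zl (State.ql ζ) (State.xcl ζ)) = 0 ∧
      grad C.Φm (C.zm (State.qm ζ) (State.xcm ζ)) + C.Kc *ᵥ State.xcm ζ = 0 := by
  rw [fderiv_Hζ_closedLoop hP hM hC, grad_Hζ hP hM hC] at h
  obtain ⟨h1, h2, h3⟩ := eq_zero_of_dotProduct_Fζ_mulVec_eq_zero hP hC hR h
  refine ⟨?_, h2, h3⟩
  -- What vanishes is the velocity `M⁻¹ p`; positive definiteness of `M⁻¹` turns this into `p = 0`.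
  rw [Robot.grad_H_momentum hP hM] at h1
  by_contra hp
  have := (Robot.M_posDef hP hM (State.q ζ (Sum.inl 1))).inv.dotProduct_mulVec_pos hp
  rw [h1, dotProduct_zero] at this
  exact this.false

/-- At the equilibrium only, the energy is stationary along the closed loop and the derivatives of
the momenta vanish. -/
theorem eq_ζs_of_fderiv_Hζ_closedLoop_eq_zero {ζ : State}
    (h : fderiv ℝ (Hζ P C) ζ (closedLoop P C ζ) = 0) (hpdot : State.p (closedLoop P C ζ) = 0) :
    ζ = ζs C := by
  obtain ⟨hp, hl, hm⟩ := of_fderiv_Hζ_closedLoop_eq_zero hP hM hC hR h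
  rw [closedLoop_eq hP hM hC, grad_Hζ hP hM hC, Fζ_mulVec, hl, hp,
    Robot.grad_H_momentum hP hM, Robot.grad_H_position_of_momentum_eq_zero hP hM, mulVec_zero,
    mulVec_zero, mulVec_zero, sub_zero, add_zero] at hpdot
  -- The link rows of `ṗ = 0` contain only the spring force, because `∇Φ_l = 0`. The motor rows then
  -- give `∇Φ_m = 0`.
  have hs : P.Ks *ᵥ (State.ql ζ - State.qm ζ) = 0 := by
    ext i
    have h1 : -((P.Ks *ᵥ (State.ql ζ - State.qm ζ)) i + 0) = 0 := congrFun hpdot (Sum.inl i)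
    rwa [add_zero, neg_eq_zero] at h1
  have hq : State.ql ζ = State.qm ζ := by
    by_contra hne
    have := (Robot.Ks_posDef hP).dotProduct_mulVec_pos (sub_ne_zero.2 hne)
    rw [hs, dotProduct_zero] at this
    exact this.false
  have hm0 : grad C.Φm (C.zm (State.qm ζ) (State.xcm ζ)) = 0 := by
    ext i
    have h1 : -(-(P.Ks *ᵥ (State.ql ζ - State.qm ζ)) i +
        grad C.Φm (C.zm (State.qm ζ) (State.xcm ζ)) i) = 0 := congrFun hpdot (Sum.inr i)
    rwa [hs, Pi.zero_apply, neg_zero, zero_add, neg_eq_zero] at h1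
  rw [hm0, zero_add] at hm
  refine State.eq_ζs hp hq ?_ ?_ ?_
  · by_contra hx
    have := hC.Kc_pos.dotProduct_mulVec_pos hx
    rw [hm, dotProduct_zero] at this
    exact this.false
  · refine eq_zero_of_mul_tanh_eq_zero hC.αl_pos hC.βl_pos fun i => ?_
    rw [← Controller.grad_Φl hC, hl, Pi.zero_apply]
  · refine eq_zero_of_mul_tanh_eq_zero hC.αm_pos hC.βm_pos fun i => ?_
    rw [← Controller.grad_Φm hC, hm0, Pi.zero_apply]

/-- The linear functionals for the LaSalle criterion are the four momentum coordinates. -/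
theorem isAsymptoticallyStable_closedLoop : IsAsymptoticallyStable (closedLoop P C) (ζs C) :=
  isAsymptoticallyStable_of_lyapunov (contDiff_closedLoop hP hM hC) (closedLoop_ζs hP hM hC)
    (contDiff_Hζ 1 hP hM) (Hζ_ζs P C) (fun _ => Hζ_pos hP hM hC)
    (fderiv_Hζ_closedLoop_nonpos hP hM hC hR)
    (fun i : LM => ContinuousLinearMap.proj (Sum.inl (Sum.inr i)))
    (fun _ h i => congrFun (of_fderiv_Hζ_closedLoop_eq_zero hP hM hC hR h).1 i)
    (fun _ h hi => eq_ζs_of_fderiv_Hζ_closedLoop_eq_zero hP hM hC hR h (funext hi))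

theorem isLyapunovFunctionOn_Hζ : IsLyapunovFunctionOn (closedLoop P C) (ζs C) (Hζ P C) univ where
  isOpen := isOpen_univ
  mem := mem_univ _
  contDiffOn := (contDiff_Hζ 1 hP hM).contDiffOn
  zero := Hζ_ζs P C
  pos _ _ := Hζ_pos hP hM hC
  deriv_nonpos ζ _ := fderiv_Hζ_closedLoop_nonpos hP hM hC hR ζ

end Stability

end FlexJointRobot

theorem proposition2 (P : FlexJointRobot.Robot) (C : FlexJointRobot.Controller)
    (hP : P.Positive) (hM : ∀ θ : ℝ, (P.Ml θ).PosDef) (hC : C.Positive)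
    (hR : (C.Rcl - (1 / 4 : ℝ) •
      ((Matrix.diagonal P.Dl)⁻¹ + (Matrix.diagonal P.Dm)⁻¹)).PosDef) :
    (∀ (ql qm xcl xcm : FlexJointRobot.Vec2) (i : Fin 2),
      |C.u ql qm xcl xcm i| ≤ C.αl i + C.αm i) ∧
    ((∀ ζ : FlexJointRobot.State, FlexJointRobot.closedLoop P C ζ =
        FlexJointRobot.Fζ P C *ᵥ FlexJointRobot.grad (FlexJointRobot.Hζ P C) ζ) ∧
      (-FlexJointRobot.symPart (FlexJointRobot.Fζ P C)).PosSemidef) ∧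
    (FlexJointRobot.IsAsymptoticallyStable
        (FlexJointRobot.closedLoop P C) (FlexJointRobot.ζs C) ∧
      FlexJointRobot.IsLyapunovFunctionOn (FlexJointRobot.closedLoop P C)
        (FlexJointRobot.ζs C) (FlexJointRobot.Hζ P C) Set.univ) := by
  open FlexJointRobot in
  exact ⟨Controller.abs_u_le hC,
    ⟨closedLoop_eq hP hM hC, neg_symPart_Fζ_posSemidef hP hC hR⟩,
    isAsymptoticallyStable_closedLoop hP hM hC hR, isLyapunovFunctionOn_Hζ hP hM hC hR⟩
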